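/- Let $M=(M,\in^M)$ be a model of ZFC (not necessarily transitive or well-founded). All spaces in $V$ are assumed to be $T_0$. If $M\models\langle X,\tau\rangle$ is a topological space, a *preinterpretation* of $X$ is a ($T_0$) topological space $\langle\hat X,\hat\tau\rangle$ together with maps $\pi\colon X\to\hat X$ and $\pi\colon\tau\to\hat\tau$ (defined on the elements of $M$ that $M$ believes to be points, respectively open sets, of $X$) such that 1. for all $x\in X$ and $O\in\tau$, $x\in O$ if and only if $\pi(x)\in\pi(O)$; 2. if $M\models O=\bigcup_{i\in I}O_i$ with $O,O_i\in\tau$, then $\pi(O)=\bigcup_{i\in I}\pi(O_i)$; and if $M\models$ "$I$ is finite and $O=\bigcap_{i\in I}O_i$" (the intersection being taken inside $X$), then $\pi(O)=\bigcap_{i\in I}\pi(O_i)$ (taken inside $\hat X$); 3. $\pi(\emptyset)=\emptyset$ and $\pi(X)=\hat X$; 4. $\{\pi(O)\colon O\in\tau\}$ is a basis of $\hat\tau$. A *reduction* of a preinterpretation $\pi_0\colon X\to\hat X_0$ to a preinterpretation $\pi_1\colon X\to\hat X_1$ is a map $h\colon\hat X_0\to\hat X_1$ with $\pi_1=h\circ\pi_0$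 on points and $h^{-1}\pi_1(O)=\pi_0(O)$ for all $O\in\tau$. An *interpretation* of $X$ is a preinterpretation to which every preinterpretation of $X$ has a reduction. If $M\models f\colon X\to Y$ is a function and $\pi\colon X\to\hat X$, $\chi\colon Y\to\hat Y$ are interpretations, an *interpretation of $f$* is a continuous map $\hat f\colon\hat X\to\hat Y$ such that $\hat f(\pi(x))=\chi(y)$ whenever $M\models f(x)=y$. **Theorem.** Suppose that $M\models$ "$\langle X,\tau\rangle$, $\langle Y,\sigma\rangle$ are regular Hausdorff spaces and $f\colon X\to Y$ is a continuous function", and let $\pi\colon X\to\hat X$ and $\chi\colon Y\to\hat Y$ be interpretations. 1. There is a unique interpretation $\hat f\colon\hat X\to\hat Y$ of $f$, that is, a unique continuous map with $\hat f(\pi(x))=\chi(f(x))$ for all $x\in X$. 2. For this $\hat f$, whenever $O\in\tau$, $P\in\sigma$ and $M\models f^{-1}P=O$, one has $\hat f^{-1}\chi(P)=\pi(O)$. 3. If moreover $M\models$ "$\langle Z,\rho\rangle$ is a regular Hausdorff space and $g\colon Y\to Z$ is a continuous function", $\xi\colon Z\to\hat Z$ is an interpretation, and $\hat f,\hat g$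 are the interpretations of $f,g$, then the interpretation of $(g\circ f)^M$ is $\hat g\circ\hat f$. 4. If $M\models$ "$f$ is a homeomorphism of $X$ and $Y$", then $\hat f$ is a homeomorphism of $\hat X$ and $\hat Y$. -/

import Mathlib

universe u v

namespace Interp

/-! ### Models of set theory

A structure for the language of set theory is a type `M` with a binary relation `∈` on it, given as
a `Membership M M` instance. No well-foundedness or transitivity is assumed. All notions "in `M`"
below are spelled with quantifiers ranging over `M` and with the membership relation of `M`. -/

/-- The only non-logical symbol of set theory: a binary relation. -/
inductive MemSymbol : ℕ → Type
  | mem : MemSymbol 2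

/-- The first-order language of set theory. -/
def setLanguage : FirstOrder.Language where
  Functions := fun _ => Empty
  Relations := MemSymbol

instance setStructure (M : Type u) [Membership M M] : setLanguage.Structure M where
  funMap := fun f => Empty.elim f
  RelMap := fun {_} r =>
    match r with
    | MemSymbol.mem => fun w => w 0 ∈ w 1

/-- `M` is a model of ZFC. The separation and replacement schemes range over all first-order
formulas of the language of set theory, with finitely many parameters `p` from `M`. -/
structure ModelsZFC (M : Type u) [Membership M M] : Prop where
  extensionality : ∀ x y : M, (∀ z : M, z ∈ x ↔ z ∈ y) → x = y
  pairing : ∀ x y : M, ∃ a : M, ∀ z : M, z ∈ a ↔ z = x ∨ z = y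
  union : ∀ a : M, ∃ b : M, ∀ z : M, z ∈ b ↔ ∃ y : M, y ∈ a ∧ z ∈ y
  powerset : ∀ a : M, ∃ b : M, ∀ z : M, z ∈ b ↔ ∀ w : M, w ∈ z → w ∈ a
  infinity : ∃ a : M, (∃ e : M, e ∈ a ∧ ∀ z : M, z ∉ e) ∧
    ∀ x : M, x ∈ a → ∃ s : M, s ∈ a ∧ ∀ z : M, z ∈ s ↔ z ∈ x ∨ z = x
  foundation : ∀ a : M, (∃ x : M, x ∈ a) → ∃ x : M, x ∈ a ∧ ∀ z : M, z ∈ a → z ∉ x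
  separation : ∀ (n : ℕ) (φ : setLanguage.Formula (Fin n ⊕ Fin 1)) (p : Fin n → M) (a : M),
    ∃ b : M, ∀ x : M, x ∈ b ↔ x ∈ a ∧ φ.Realize (Sum.elim p ![x])
  replacement : ∀ (n : ℕ) (φ : setLanguage.Formula (Fin n ⊕ Fin 2)) (p : Fin n → M) (a : M),
    (∀ x : M, x ∈ a → ∀ y y' : M, φ.Realize (Sum.elim p ![x, y]) →
      φ.Realize (Sum.elim p ![x, y']) → y = y') →
    ∃ b : M, ∀ y : M, y ∈ b ↔ ∃ x : M, x ∈ a ∧ φ.Realize (Sum.elim p ![x, y])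
  choice : ∀ a : M, (∀ x : M, x ∈ a → ∃ z : M, z ∈ x) →
    (∀ x y : M, x ∈ a → y ∈ a → (∃ z : M, z ∈ x ∧ z ∈ y) → x = y) →
    ∃ c : M, ∀ x : M, x ∈ a → ∃! z : M, z ∈ x ∧ z ∈ c

section

variable {M : Type u} [Membership M M]

/-- `M ⊨ p = ⟨x, y⟩ = {{x}, {x, y}}`. -/
def IsPair (p x y : M) : Prop :=
  ∀ z : M, z ∈ p ↔ (∀ w : M, w ∈ z ↔ w = x) ∨ (∀ w : M, w ∈ z ↔ w = x ∨ w = y)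

/-- `M ⊨ ⟨x, y⟩ ∈ f`; for a function `f` of `M` this says `M ⊨ f(x) = y`. -/
def PairMem (f x y : M) : Prop :=
  ∃ p : M, p ∈ f ∧ IsPair p x y

/-- `M ⊨ f` is a function from `A` to `B`. -/
def IsFunction (f A B : M) : Prop :=
  (∀ p : M, p ∈ f → ∃ x y : M, x ∈ A ∧ y ∈ B ∧ IsPair p x y) ∧
    ∀ x : M, x ∈ A → ∃! y : M, PairMem f x y

/-- `M ⊨ h = g ∘ f`. -/
def IsComp (h g f : M) : Prop :=
  ∀ p : M, p ∈ h ↔ ∃ x y z : M, PairMem f x y ∧ PairMem g y z ∧ IsPair p x z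

/-- `M ⊨ O = f⁻¹P`, for a function `f` with domain `A`. -/
def IsPreimage (f A P O : M) : Prop :=
  ∀ x : M, x ∈ O ↔ x ∈ A ∧ ∃ y : M, y ∈ P ∧ PairMem f x y

/-- `M ⊨ I` is finite: `I` belongs to every family of sets that contains the empty set and is
closed under adding one element of `I`. -/
def IsFinite (I : M) : Prop :=
  ∀ F : M, (∀ e : M, (∀ z : M, z ∉ e) → e ∈ F) →
    (∀ B i C : M, B ∈ F → i ∈ I → (∀ z : M, z ∈ C ↔ z ∈ B ∨ z = i) → C ∈ F) → I ∈ F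

end

/-! ### Topological spaces in the model -/

/-- A pair `⟨X, τ⟩` of elements of `M` such that `M ⊨ ⟨X, τ⟩` is a topological space. -/
structure SpaceIn (M : Type u) [Membership M M] where
  carrier : M
  opens : M
  subset_carrier : ∀ O : M, O ∈ opens → ∀ x : M, x ∈ O → x ∈ carrier
  carrier_mem : carrier ∈ opens
  empty_mem : ∃ e : M, e ∈ opens ∧ ∀ z : M, z ∉ e
  inter_mem : ∀ O P : M, O ∈ opens → P ∈ opens →
    ∃ Q : M, Q ∈ opens ∧ ∀ x : M, x ∈ Q ↔ x ∈ O ∧ x ∈ P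
  union_mem : ∀ A : M, (∀ O : M, O ∈ A → O ∈ opens) →
    ∃ U : M, U ∈ opens ∧ ∀ x : M, x ∈ U ↔ ∃ O : M, O ∈ A ∧ x ∈ O

namespace SpaceIn

variable {M : Type u} [Membership M M]

/-- The points of `X`, as a type. -/
abbrev Pt (X : SpaceIn M) : Type u := {x : M // x ∈ X.carrier}

/-- The open sets of `X` that belong to `M`, as a type. -/
abbrev Op (X : SpaceIn M) : Type u := {O : M // O ∈ X.opens}

/-- `M ⊨ X` is a regular Hausdorff space. -/
def RegularHausdorff (X : SpaceIn M) : Prop :=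
  (∀ x y : M, x ∈ X.carrier → y ∈ X.carrier → x ≠ y →
    ∃ U V : M, U ∈ X.opens ∧ V ∈ X.opens ∧ x ∈ U ∧ y ∈ V ∧ ∀ z : M, ¬ (z ∈ U ∧ z ∈ V)) ∧
  (∀ x O : M, O ∈ X.opens → x ∈ O →
    ∃ U V : M, U ∈ X.opens ∧ V ∈ X.opens ∧ x ∈ U ∧
      (∀ z : M, z ∈ X.carrier → z ∉ O → z ∈ V) ∧ ∀ z : M, ¬ (z ∈ U ∧ z ∈ V))

/-- `M ⊨ f : X → Y` is a continuous function. -/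
def ContinuousMap (X Y : SpaceIn M) (f : M) : Prop :=
  IsFunction f X.carrier Y.carrier ∧
    ∀ P : M, P ∈ Y.opens → ∃ O : M, O ∈ X.opens ∧ IsPreimage f X.carrier P O

/-- `M ⊨ f : X → Y` is a homeomorphism: a continuous function with a continuous inverse. -/
def Homeomorphism (X Y : SpaceIn M) (f : M) : Prop :=
  ContinuousMap X Y f ∧
    ∃ g : M, ContinuousMap Y X g ∧ ∀ x y : M, PairMem f x y ↔ PairMem g y x

end SpaceIn

/-! ### Interpretations -/

variable {M : Type u} [Membership M M]

/-- A topological preinterpretation of a space `X` of `M` in a (T₀) topological space `X'`: a map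
`pt` on the points and a map `op` on the open sets of `X` that belong to `M`. In `map_union` and
`map_inter`, `F ∈ M` is an indexed family `⟨O_i : i ∈ I⟩` of open sets; the intersection of a family
is taken inside `X`, and finiteness of `I` is meant in `M`. -/
structure Preinterpretation (X : SpaceIn M) (X' : Type v) [TopologicalSpace X'] where
  pt : X.Pt → X'
  op : X.Op → TopologicalSpace.Opens X'
  t0 : T0Space X'
  mem_iff : ∀ (x : X.Pt) (O : X.Op), x.1 ∈ O.1 ↔ pt x ∈ op O
  map_union : ∀ (I F : M) (O : X.Op), IsFunction F I X.opens →
    (∀ x : M, x ∈ O.1 ↔ ∃ i P : M, i ∈ I ∧ PairMem F i P ∧ x ∈ P) →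
    ∀ z : X', z ∈ op O ↔ ∃ (i : M) (P : X.Op), i ∈ I ∧ PairMem F i P.1 ∧ z ∈ op P
  map_inter : ∀ (I F : M) (O : X.Op), IsFunction F I X.opens → IsFinite I →
    (∀ x : M, x ∈ O.1 ↔ x ∈ X.carrier ∧ ∀ i P : M, i ∈ I → PairMem F i P → x ∈ P) →
    ∀ z : X', z ∈ op O ↔ ∀ (i : M) (P : X.Op), i ∈ I → PairMem F i P.1 → z ∈ op P
  map_empty : ∀ O : X.Op, (∀ x : M, x ∉ O.1) → op O = ⊥
  map_carrier : op ⟨X.carrier, X.carrier_mem⟩ = ⊤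
  isBasis : TopologicalSpace.Opens.IsBasis (Set.range op)

/-- `h` is a reduction of the preinterpretation `π₀` to the preinterpretation `π₁`. -/
def IsReduction {X : SpaceIn M} {X₀ X₁ : Type v} [TopologicalSpace X₀] [TopologicalSpace X₁]
    (π₀ : Preinterpretation X X₀) (π₁ : Preinterpretation X X₁) (h : X₀ → X₁) : Prop :=
  (∀ x : X.Pt, π₁.pt x = h (π₀.pt x)) ∧
    ∀ O : X.Op, h ⁻¹' (π₁.op O : Set X₁) = (π₀.op O : Set X₀)

/-- An interpretation is a largest preinterpretation: every preinterpretation reduces to it. -/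
def IsInterpretation {X : SpaceIn M} {X' : Type v} [TopologicalSpace X']
    (π : Preinterpretation X X') : Prop :=
  ∀ (Z : Type v) [TopologicalSpace Z] (ρ : Preinterpretation X Z),
    ∃ h : Z → X', IsReduction ρ π h

/-- `f'` is an interpretation of the function `f : X → Y` of `M`: it is continuous and
`f' (π x) = χ y` whenever `M ⊨ f(x) = y`. -/
def IsMapInterpretation {X Y : SpaceIn M} {X' Y' : Type v} [TopologicalSpace X']
    [TopologicalSpace Y'] (π : Preinterpretation X X') (χ : Preinterpretation Y Y') (f : M)
    (f' : X' → Y') : Prop :=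
  Continuous f' ∧ ∀ (x : X.Pt) (y : Y.Pt), PairMem f x.1 y.1 → f' (π.pt x) = χ.pt y

end Interp

open Interp

/-! Existence uses maximality of `χ`. The sets `π(f⁻¹P)` on `X̂` respect the unions and finite
intersections of `M`, because `f⁻¹` does so inside `M`, but `X̂` has no points to assign to those `y
∈ Y` outside the range of `f`. The disjoint union of `Ŷ` and `X̂`, with the sets `χ(P) ⊔ π(f⁻¹P)`
and the points of `Y` sent to `Ŷ`, repairs this; its T₀ quotient is a preinterpretation of `Y`.
Restricting its reduction to `X̂` gives `f̂` with `f̂⁻¹χ(P) = π(f⁻¹P)`, hence continuity and the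
preimage formula, and `f̂(π x) = χ(f x)` because `Ŷ` is T₀ (`exists_map`,
`exists_isMapInterpretation`). Regularity plays no role here.

Uniqueness holds because `π(X)` is dense (`denseRange_pt`) and `Ŷ` is Hausdorff (`t2Space`):
regularity is expressed in `M` by unions and intersections of open sets, which preinterpretations
preserve. Composition and inverses follow from the same density argument.

Definability is needed only to apply separation and replacement in `M`. -/

namespace Interp

/-! ### First-order definability in the language of set theory -/

section Definability

variable {M : Type u} [Membership M M] {α : Type}

/-- The relation `R` on assignments `α → M` is defined by a formula of the language of set theory
without parameters. -/
def FODefinable (R : (α → M) → Prop) : Prop :=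
  ∃ φ : setLanguage.Formula α, ∀ v : α → M, φ.Realize v ↔ R v

namespace FODefinable

theorem mem (a b : α) : FODefinable fun v : α → M => v a ∈ v b :=
  ⟨FirstOrder.Language.Relations.formula₂ (L := setLanguage) MemSymbol.mem (.var a) (.var b),
    fun _ => FirstOrder.Language.Formula.realize_rel₂ (L := setLanguage)⟩

theorem eq (a b : α) : FODefinable fun v : α → M => v a = v b :=
  ⟨FirstOrder.Language.Term.equal (.var a) (.var b), fun v => by simp⟩

theorem not {R : (α → M) → Prop} (hR : FODefinable R) : FODefinable fun v => ¬ R v := by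
  obtain ⟨φ, hφ⟩ := hR
  exact ⟨φ.not, fun v => by rw [FirstOrder.Language.Formula.realize_not, hφ]⟩

theorem imp {R S : (α → M) → Prop} (hR : FODefinable R) (hS : FODefinable S) :
    FODefinable fun v => R v → S v := by
  obtain ⟨φ, hφ⟩ := hR
  obtain ⟨ψ, hψ⟩ := hS
  exact ⟨φ.imp ψ, fun v => by rw [FirstOrder.Language.Formula.realize_imp, hφ, hψ]⟩

theorem and {R S : (α → M) → Prop} (hR : FODefinable R) (hS : FODefinable S) :
    FODefinable fun v => R v ∧ S v := by
  simpa only [Classical.not_imp, not_not] using (hR.imp hS.not).not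

theorem or {R S : (α → M) → Prop} (hR : FODefinable R) (hS : FODefinable S) :
    FODefinable fun v => R v ∨ S v := by
  simpa only [or_iff_not_imp_left] using hR.not.imp hS

theorem iff {R S : (α → M) → Prop} (hR : FODefinable R) (hS : FODefinable S) :
    FODefinable fun v => (R v ↔ S v) := by
  simpa only [iff_iff_implies_and_implies] using (hR.imp hS).and (hS.imp hR)

theorem all {R : (α → M) → M → Prop}
    (hR : FODefinable fun v : α ⊕ Fin 1 → M => R (fun a => v (.inl a)) (v (.inr 0))) :
    FODefinable fun v => ∀ x, R v x := by
  obtain ⟨φ, hφ⟩ := hR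
  refine ⟨φ.iAlls (Fin 1), fun v => ?_⟩
  rw [FirstOrder.Language.Formula.realize_iAlls]
  constructor
  · intro h x
    exact (hφ _).1 (h fun _ => x)
  · intro h i
    exact (hφ _).2 (h (i 0))

theorem ex {R : (α → M) → M → Prop}
    (hR : FODefinable fun v : α ⊕ Fin 1 → M => R (fun a => v (.inl a)) (v (.inr 0))) :
    FODefinable fun v => ∃ x, R v x := by
  simpa only [not_forall, not_not] using (all (R := fun v x => ¬ R v x) hR.not).not

theorem isPair (p x y : α) : FODefinable fun v : α → M => IsPair (v p) (v x) (v y) :=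
  all (iff (mem _ _) (or (all (iff (mem _ _) (eq _ _)))
    (all (iff (mem _ _) (or (eq _ _) (eq _ _))))))

theorem pairMem (f x y : α) : FODefinable fun v : α → M => PairMem (v f) (v x) (v y) :=
  ex (and (mem _ _) (isPair _ _ _))

theorem isPreimage (f A P O : α) :
    FODefinable fun v : α → M => IsPreimage (v f) (v A) (v P) (v O) :=
  all (iff (mem _ _) (and (mem _ _) (ex (and (mem _ _) (pairMem _ _ _)))))

end FODefinable

end Definability

/-! ### Elementary set theory in the model -/

section SetTheory

variable {M : Type u} [Membership M M]

theorem ModelsZFC.exists_sep (hM : ModelsZFC M) {n : ℕ} {R : (Fin n ⊕ Fin 1 → M) → Prop}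
    (hR : FODefinable R) (p : Fin n → M) (a : M) :
    ∃ b : M, ∀ x, x ∈ b ↔ x ∈ a ∧ R (Sum.elim p ![x]) := by
  obtain ⟨φ, hφ⟩ := hR
  simpa only [hφ] using hM.separation n φ p a

theorem ModelsZFC.exists_image (hM : ModelsZFC M) {n : ℕ} {R : (Fin n ⊕ Fin 2 → M) → Prop}
    (hR : FODefinable R) (p : Fin n → M) (a : M)
    (hfun : ∀ x ∈ a, ∀ y y', R (Sum.elim p ![x, y]) → R (Sum.elim p ![x, y']) → y = y') :
    ∃ b : M, ∀ y, y ∈ b ↔ ∃ x, x ∈ a ∧ R (Sum.elim p ![x, y]) := by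
  obtain ⟨φ, hφ⟩ := hR
  simpa only [hφ] using hM.replacement n φ p a (by simpa only [hφ] using hfun)

theorem ModelsZFC.exists_isPair (hM : ModelsZFC M) (x y : M) : ∃ p : M, IsPair p x y := by
  obtain ⟨a, ha⟩ := hM.pairing x x
  obtain ⟨b, hb⟩ := hM.pairing x y
  obtain ⟨p, hp⟩ := hM.pairing a b
  refine ⟨p, fun z => ?_⟩
  rw [hp]
  refine or_congr ⟨?_, fun h => ?_⟩ ⟨?_, fun h => ?_⟩
  · rintro rfl w
    simp [ha]
  · exact hM.extensionality _ _ fun w => by simp [h, ha]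
  · rintro rfl w
    exact hb w
  · exact hM.extensionality _ _ fun w => by rw [h, hb]

theorem IsPair.unique (hM : ModelsZFC M) {p q x y : M} (hp : IsPair p x y) (hq : IsPair q x y) :
    p = q :=
  hM.extensionality _ _ fun z => (hp z).trans (hq z).symm

theorem IsPair.inj (hM : ModelsZFC M) {p x y x' y' : M} (h : IsPair p x y)
    (h' : IsPair p x' y') : x = x' ∧ y = y' := by
  obtain ⟨a, ha⟩ := hM.pairing x x
  obtain ⟨b, hb⟩ := hM.pairing x y
  obtain ⟨b', hb'⟩ := hM.pairing x' y'
  -- `{x}` and `{x, y}` belong to `p` by one description and `{x', y'}` by the other; each must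
  -- match an alternative of the opposite description.
  have ha2 := (h' a).1 ((h a).2 (Or.inl fun w => by simp [ha]))
  have hb2 := (h' b).1 ((h b).2 (Or.inr hb))
  have hb3 := (h b').1 ((h' b').2 (Or.inr hb'))
  simp only [ha, hb, hb', or_self] at ha2 hb2 hb3
  have hx : x' = x := by
    rcases ha2 with h1 | h1
    · exact (h1 x').2 rfl
    · exact (h1 x').2 (Or.inl rfl)
  subst hx
  refine ⟨rfl, ?_⟩
  have hy : y = x' ∨ y = y' := by
    rcases hb2 with h1 | h1
    · exact Or.inl ((h1 y).1 (Or.inr rfl))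
    · exact (h1 y).1 (Or.inr rfl)
  have hy' : y' = x' ∨ y' = y := by
    rcases hb3 with h1 | h1
    · exact Or.inl ((h1 y').1 (Or.inr rfl))
    · exact (h1 y').1 (Or.inr rfl)
  grind

theorem IsFunction.mem_of_pairMem (hM : ModelsZFC M) {f A B x y : M} (hf : IsFunction f A B)
    (h : PairMem f x y) : x ∈ A ∧ y ∈ B := by
  obtain ⟨p, hp, hxy⟩ := h
  obtain ⟨x', y', hx, hy, hxy'⟩ := hf.1 p hp
  obtain ⟨rfl, rfl⟩ := hxy.inj hM hxy'
  exact ⟨hx, hy⟩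

theorem IsFunction.eq_of_pairMem (hM : ModelsZFC M) {f A B x y y' : M} (hf : IsFunction f A B)
    (h : PairMem f x y) (h' : PairMem f x y') : y = y' :=
  (hf.2 x (hf.mem_of_pairMem hM h).1).unique h h'

theorem IsFunction.exists_mem (hM : ModelsZFC M) {f A B x : M} (hf : IsFunction f A B)
    (hx : x ∈ A) : ∃ y ∈ B, PairMem f x y := by
  obtain ⟨y, hy, -⟩ := hf.2 x hx
  exact ⟨y, (hf.mem_of_pairMem hM hy).2, hy⟩

theorem IsPreimage.unique (hM : ModelsZFC M) {f A P O O' : M} (h : IsPreimage f A P O)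
    (h' : IsPreimage f A P O') : O = O' :=
  hM.extensionality _ _ fun z => (h z).trans (h' z).symm

theorem IsPreimage.mem_iff_of_pairMem (hM : ModelsZFC M) {f A B P O x y : M}
    (hf : IsFunction f A B) (h : IsPreimage f A P O) (hxy : PairMem f x y) :
    x ∈ O ↔ y ∈ P := by
  rw [h x]
  constructor
  · rintro ⟨-, y', hy', hxy'⟩
    rwa [hf.eq_of_pairMem hM hxy hxy']
  · exact fun hy => ⟨(hf.mem_of_pairMem hM hxy).1, y, hy, hxy⟩

theorem pairMem_comp_iff (hM : ModelsZFC M) {f g h x z : M} (hh : IsComp h g f) :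
    PairMem h x z ↔ ∃ y, PairMem f x y ∧ PairMem g y z := by
  constructor
  · rintro ⟨p, hp, hxz⟩
    obtain ⟨x', y, z', hf, hg, hxz'⟩ := (hh p).1 hp
    obtain ⟨rfl, rfl⟩ := hxz.inj hM hxz'
    exact ⟨y, hf, hg⟩
  · rintro ⟨y, hf, hg⟩
    obtain ⟨p, hp⟩ := hM.exists_isPair x z
    exact ⟨p, (hh p).2 ⟨x, y, z, hf, hg, hp⟩, hp⟩

/-- The identity function of `A`, as a family of elements of `B`. -/
theorem ModelsZFC.exists_identity_family (hM : ModelsZFC M) {A B : M} (hAB : ∀ x ∈ A, x ∈ B) :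
    ∃ F : M, IsFunction F A B ∧ ∀ x y, PairMem F x y ↔ x ∈ A ∧ y = x := by
  obtain ⟨F, hF⟩ := hM.exists_image (n := 0)
    (FODefinable.isPair (Sum.inr 1) (Sum.inr 0) (Sum.inr 0)) ![] A
    fun x _ p q hp hq => IsPair.unique hM hp hq
  simp only [Sum.elim_inr, Matrix.cons_val_zero, Matrix.cons_val_one] at hF
  have key : ∀ x y, PairMem F x y ↔ x ∈ A ∧ y = x := by
    refine fun x y => ⟨?_, ?_⟩
    · rintro ⟨p, hp, hxy⟩
      obtain ⟨w, hw, hp⟩ := (hF p).1 hp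
      obtain ⟨rfl, rfl⟩ := hxy.inj hM hp
      exact ⟨hw, rfl⟩
    · rintro ⟨hx, rfl⟩
      obtain ⟨p, hp⟩ := hM.exists_isPair y y
      exact ⟨p, (hF p).2 ⟨y, hx, hp⟩, hp⟩
  refine ⟨F, ⟨fun p hp => ?_, fun x hx => ⟨x, (key x x).2 ⟨hx, rfl⟩, fun y hy => ?_⟩⟩, key⟩
  · obtain ⟨w, hw, hp⟩ := (hF p).1 hp
    exact ⟨w, w, hw, hAB w hw, hp⟩
  · exact ((key x y).1 hy).2

/-- The pullback `⟨f⁻¹(F_i) : i ∈ I⟩` of a family of open sets along a continuous function. -/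
theorem SpaceIn.ContinuousMap.exists_pullback_family (hM : ModelsZFC M) {X Y : SpaceIn M}
    {f I F : M} (hf : SpaceIn.ContinuousMap X Y f) (hF : IsFunction F I Y.opens) :
    ∃ G : M, IsFunction G I X.opens ∧
      ∀ i O, PairMem G i O ↔ ∃ P, PairMem F i P ∧ IsPreimage f X.carrier P O := by
  -- Replacement sends `i` to the pair `⟨i, f⁻¹(F_i)⟩`; it is single-valued because preimages are
  -- unique by extensionality.
  obtain ⟨G, hG⟩ := hM.exists_image (n := 3)
    (R := fun v => ∃ P O, PairMem (v (.inl 0)) (v (.inr 0)) P ∧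
      IsPreimage (v (.inl 1)) (v (.inl 2)) P O ∧ IsPair (v (.inr 1)) (v (.inr 0)) O)
    (.ex (.ex (.and (.pairMem _ _ _) (.and (.isPreimage _ _ _ _) (.isPair _ _ _)))))
    ![F, f, X.carrier] I (by
      rintro i hi p q ⟨P, O, hP, hO, hp⟩ ⟨P', O', hP', hO', hq⟩
      obtain rfl := hF.eq_of_pairMem hM hP hP'
      obtain rfl := hO.unique hM hO'
      exact IsPair.unique hM hp hq)
  have hG : ∀ p, p ∈ G ↔ ∃ i, i ∈ I ∧ ∃ P O, PairMem F i P ∧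
      IsPreimage f X.carrier P O ∧ IsPair p i O := hG
  have key : ∀ i O, PairMem G i O ↔ ∃ P, PairMem F i P ∧ IsPreimage f X.carrier P O := by
    intro i O
    constructor
    · rintro ⟨p, hp, hiO⟩
      obtain ⟨i', -, P, O', hP, hO, hp⟩ := (hG p).1 hp
      obtain ⟨rfl, rfl⟩ := hiO.inj hM hp
      exact ⟨P, hP, hO⟩
    · rintro ⟨P, hP, hO⟩
      obtain ⟨p, hp⟩ := hM.exists_isPair i O
      exact ⟨p, (hG p).2 ⟨i, (hF.mem_of_pairMem hM hP).1, P, O, hP, hO, hp⟩, hp⟩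
  refine ⟨G, ⟨fun p hp => ?_, fun i hi => ?_⟩, key⟩
  · obtain ⟨i, hi, P, O, hP, hO, hp⟩ := (hG p).1 hp
    obtain ⟨O', hO'X, hO'⟩ := hf.2 P (hF.mem_of_pairMem hM hP).2
    obtain rfl := hO.unique hM hO'
    exact ⟨i, O, hi, hO'X, hp⟩
  · obtain ⟨P, hPY, hP⟩ := hF.exists_mem hM hi
    obtain ⟨O, -, hO⟩ := hf.2 P hPY
    refine ⟨O, (key i O).2 ⟨P, hP, hO⟩, fun O' hO' => ?_⟩
    obtain ⟨P', hP', hO'⟩ := (key i O').1 hO'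
    obtain rfl := hF.eq_of_pairMem hM hP hP'
    exact hO'.unique hM hO

/-- Two additions reach the set: `∅`, `{P}`, `{P, Q}`. The case `P = Q` needs no separate treatment.
-/
theorem ModelsZFC.isFinite_pair (hM : ModelsZFC M) {A P Q : M}
    (hA : ∀ z, z ∈ A ↔ z = P ∨ z = Q) : IsFinite A := by
  intro F hempty hadd
  obtain ⟨-, ⟨e, -, he⟩, -⟩ := hM.infinity
  obtain ⟨s, hs⟩ := hM.pairing P P
  have hsF : s ∈ F := hadd e P s (hempty e he) ((hA P).2 (Or.inl rfl)) fun z => by simp [hs, he]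
  exact hadd s Q A hsF ((hA Q).2 (Or.inr rfl)) fun z => by simp [hs, hA]

end SetTheory

/-! ### Topological properties of preinterpretations -/

section Preinterpretation

variable {M : Type u} [Membership M M] {X Y : SpaceIn M}

/-- If an open set of `M` is the union of a set `A ∈ M` of open sets, so are their images. -/
theorem Preinterpretation.mem_op_iff_of_sUnion (hM : ModelsZFC M) {X' : Type v}
    [TopologicalSpace X'] (π : Preinterpretation X X') {A : M} (hA : ∀ P ∈ A, P ∈ X.opens)
    (O : X.Op) (hO : ∀ x, x ∈ O.1 ↔ ∃ P ∈ A, x ∈ P) (z : X') :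
    z ∈ π.op O ↔ ∃ P : X.Op, P.1 ∈ A ∧ z ∈ π.op P := by
  -- Preinterpretations preserve unions of indexed families, so `A` is indexed by itself.
  obtain ⟨F, hF, hFA⟩ := hM.exists_identity_family hA
  rw [π.map_union A F O hF (fun x => by rw [hO]; simp only [hFA]; grind)]
  simp only [hFA]
  grind

theorem Preinterpretation.mem_op_iff_of_union (hM : ModelsZFC M) {X' : Type v}
    [TopologicalSpace X'] (π : Preinterpretation X X') (O P Q : X.Op)
    (hO : ∀ x, x ∈ O.1 ↔ x ∈ P.1 ∨ x ∈ Q.1) (z : X') :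
    z ∈ π.op O ↔ z ∈ π.op P ∨ z ∈ π.op Q := by
  obtain ⟨A, hA⟩ := hM.pairing P.1 Q.1
  rw [π.mem_op_iff_of_sUnion hM (A := A) (by grind) O (by grind)]
  simp only [hA, ← Subtype.ext_iff]
  grind

/-- A family of subsets of `W` indexed by the open sets of `Y`, compatible with finite
intersections in `M`, is compatible with binary intersections. -/
theorem mem_iff_of_inter (hM : ModelsZFC M) {W : Type v} {U : Y.Op → Set W}
    (hU : ∀ (I F : M) (O : Y.Op), IsFunction F I Y.opens → IsFinite I →
      (∀ x : M, x ∈ O.1 ↔ x ∈ Y.carrier ∧ ∀ i P : M, i ∈ I → PairMem F i P → x ∈ P) →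
      ∀ z : W, z ∈ U O ↔ ∀ (i : M) (P : Y.Op), i ∈ I → PairMem F i P.1 → z ∈ U P)
    (O P Q : Y.Op) (hO : ∀ x, x ∈ O.1 ↔ x ∈ P.1 ∧ x ∈ Q.1) (z : W) :
    z ∈ U O ↔ z ∈ U P ∧ z ∈ U Q := by
  obtain ⟨A, hA⟩ := hM.pairing P.1 Q.1
  obtain ⟨F, hF, hFA⟩ := hM.exists_identity_family (A := A) (B := Y.opens) (by grind)
  rw [hU A F O hF (hM.isFinite_pair hA) fun x => ?_]
  · simp only [hFA, hA]
    constructor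
    · exact fun h => ⟨h P.1 P (by simp) (by simp), h Q.1 Q (by simp) (by simp)⟩
    · rintro ⟨hP, hQ⟩ i R - ⟨h | h, hR⟩
      · obtain rfl : R = P := Subtype.ext (hR.trans h)
        exact hP
      · obtain rfl : R = Q := Subtype.ext (hR.trans h)
        exact hQ
  · have := Y.subset_carrier P.1 P.2 x
    simp only [hFA, hA, hO]
    constructor
    · grind
    · exact fun h => ⟨h.2 P.1 P.1 (by simp) (by simp), h.2 Q.1 Q.1 (by simp) (by simp)⟩

/-- A nonempty basic open set is `π(O)` with `O` nonempty in `M`, since `π(∅) = ∅`; any point of `O`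
then lands in it. -/
theorem Preinterpretation.denseRange_pt {X' : Type v} [TopologicalSpace X']
    (π : Preinterpretation X X') : DenseRange π.pt := by
  intro z
  rw [π.isBasis.mem_closure_iff]
  rintro _ ⟨_, ⟨O, rfl⟩, rfl⟩ hz
  by_cases h : ∃ x, x ∈ O.1
  · obtain ⟨x, hx⟩ := h
    exact ⟨_, (π.mem_iff ⟨x, X.subset_carrier O.1 O.2 x hx⟩ O).1 hx, ⟨_, rfl⟩⟩
  · rw [π.map_empty O (not_exists.1 h)] at hz
    exact hz.elim

/-- Every point of an open set is separated, inside the image of a regular space, from the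
complement of that open set. -/
theorem Preinterpretation.exists_separation (hM : ModelsZFC M) (hX : X.RegularHausdorff)
    {X' : Type v} [TopologicalSpace X'] (π : Preinterpretation X X') {z : X'} {O : X.Op}
    (hz : z ∈ π.op O) :
    ∃ U V : X.Op, z ∈ π.op U ∧ (∀ w, w ∉ π.op O → w ∈ π.op V) ∧
      Disjoint (π.op U : Set X') (π.op V) := by
  -- `A` is the set of open `U` disjoint from some open `V` that covers the complement of `O`.
  -- Regularity in `M` says `O = ⋃ A`, so `z` lies in `π(U)` for some `U ∈ A`.
  obtain ⟨A, hA⟩ := hM.exists_sep (n := 3)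
    (R := fun v => ∃ V, V ∈ v (.inl 0) ∧
      (∀ z, z ∈ v (.inl 1) → ¬ z ∈ v (.inl 2) → z ∈ V) ∧ ∀ z, ¬ (z ∈ v (.inr 0) ∧ z ∈ V))
    (.ex (.and (.mem _ _) (.and (.all (.imp (.mem _ _) (.imp (.not (.mem _ _)) (.mem _ _))))
      (.all (.not (.and (.mem _ _) (.mem _ _)))))))
    ![X.opens, X.carrier, O.1] X.opens
  have hA : ∀ U, U ∈ A ↔ U ∈ X.opens ∧ ∃ V, V ∈ X.opens ∧
    (∀ z, z ∈ X.carrier → ¬ z ∈ O.1 → z ∈ V) ∧ ∀ z, ¬ (z ∈ U ∧ z ∈ V) := hA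
  obtain ⟨U, hUA, hzU⟩ := (π.mem_op_iff_of_sUnion hM (A := A) (fun P hP => ((hA P).1 hP).1) O
    (fun x => ⟨fun hx => by
      obtain ⟨U, V, hU, hV, hxU, h1, h2⟩ := hX.2 x O.1 O.2 hx
      exact ⟨U, (hA U).2 ⟨hU, V, hV, h1, h2⟩, hxU⟩, by
      rintro ⟨U, hU, hxU⟩
      obtain ⟨hU, V, hV, h1, h2⟩ := (hA U).1 hU
      by_contra hx
      exact h2 x ⟨hxU, h1 x (X.subset_carrier U hU x hxU) hx⟩⟩) z).1 hz
  obtain ⟨-, V, hV, h1, h2⟩ := (hA U.1).1 hUA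
  refine ⟨U, ⟨V, hV⟩, hzU, fun w hw => ?_, ?_⟩
  -- `X = O ∪ V` in `M`, hence `X̂ = π(O) ∪ π(V)`.
  · have := (π.mem_op_iff_of_union hM ⟨X.carrier, X.carrier_mem⟩ O ⟨V, hV⟩ (fun x => by
      have := X.subset_carrier O.1 O.2 x
      have := X.subset_carrier V hV x
      grind) w).1 (by rw [π.map_carrier]; trivial)
    exact this.resolve_left hw
  -- `U ∩ V = ∅` in `M`, hence `π(U) ∩ π(V) = π(∅) = ∅`.
  · obtain ⟨e, he, hempty⟩ := X.empty_mem
    rw [Set.disjoint_left]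
    intro w hwU hwV
    have := (mem_iff_of_inter hM (U := fun O => (π.op O : Set X')) π.map_inter ⟨e, he⟩ U ⟨V, hV⟩
      (fun x => iff_of_false (hempty x) (h2 x)) w).2 ⟨hwU, hwV⟩
    rw [π.map_empty ⟨e, he⟩ hempty] at this
    exact this

theorem Preinterpretation.exists_op_separating {X' : Type v} [TopologicalSpace X']
    (π : Preinterpretation X X') {z w : X'} (h : z ≠ w) :
    ∃ O : X.Op, ¬ (z ∈ π.op O ↔ w ∈ π.op O) := by
  by_contra! hO
  have := π.t0
  refine h (π.isBasis.inseparable_iff.2 ?_).eq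
  rintro _ ⟨_, ⟨O, rfl⟩, rfl⟩
  exact hO O

/-- By T₀ some `π(O)` contains exactly one of the two points; separating that point from the
complement of `π(O)` separates the two. -/
theorem Preinterpretation.t2Space (hM : ModelsZFC M) (hX : X.RegularHausdorff)
    {X' : Type v} [TopologicalSpace X'] (π : Preinterpretation X X') : T2Space X' := by
  refine ⟨fun z w hzw => ?_⟩
  obtain ⟨O, hO⟩ := π.exists_op_separating hzw
  by_cases hz : z ∈ π.op O
  · obtain ⟨U, V, hU, hV, hUV⟩ := π.exists_separation hM hX hz
    exact ⟨_, _, (π.op U).2, (π.op V).2, hU, hV w (by tauto), hUV⟩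
  · obtain ⟨U, V, hU, hV, hUV⟩ := π.exists_separation hM hX (z := w) (O := O) (by tauto)
    exact ⟨_, _, (π.op V).2, (π.op U).2, hV z hz, hU, hUV.symm⟩

/-- A continuous map between preinterpretations, the target being regular Hausdorff in `M`, is
determined by its values at the points of `M`. -/
theorem IsMapInterpretation.unique (hM : ModelsZFC M) (hY : Y.RegularHausdorff)
    {X' Y' : Type v} [TopologicalSpace X'] [TopologicalSpace Y'] {π : Preinterpretation X X'}
    {χ : Preinterpretation Y Y'} {f : M}
    (hf : ∀ x ∈ X.carrier, ∃ y ∈ Y.carrier, PairMem f x y) {f₁ f₂ : X' → Y'}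
    (h₁ : IsMapInterpretation π χ f f₁) (h₂ : IsMapInterpretation π χ f f₂) : f₁ = f₂ := by
  have := χ.t2Space hM hY
  refine π.denseRange_pt.equalizer h₁.1 h₂.1 (funext fun x => ?_)
  obtain ⟨y, hy, hxy⟩ := hf x.1 x.2
  exact (h₁.2 x ⟨y, hy⟩ hxy).trans (h₂.2 x ⟨y, hy⟩ hxy).symm

/-- Any set `W` carrying compatible subsets for the open sets of `Y` maps to the interpretation:
identify the points of `W` that lie in the same subsets and apply maximality. -/
theorem IsInterpretation.exists_map (hM : ModelsZFC M) {Y' : Type v} [TopologicalSpace Y']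
    {χ : Preinterpretation Y Y'} (hχ : IsInterpretation χ) {W : Type v} (pt : Y.Pt → W)
    (U : Y.Op → Set W) (mem_iff : ∀ (x : Y.Pt) (O : Y.Op), x.1 ∈ O.1 ↔ pt x ∈ U O)
    (map_union : ∀ (I F : M) (O : Y.Op), IsFunction F I Y.opens →
      (∀ x : M, x ∈ O.1 ↔ ∃ i P : M, i ∈ I ∧ PairMem F i P ∧ x ∈ P) →
      ∀ z : W, z ∈ U O ↔ ∃ (i : M) (P : Y.Op), i ∈ I ∧ PairMem F i P.1 ∧ z ∈ U P)
    (map_inter : ∀ (I F : M) (O : Y.Op), IsFunction F I Y.opens → IsFinite I →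
      (∀ x : M, x ∈ O.1 ↔ x ∈ Y.carrier ∧ ∀ i P : M, i ∈ I → PairMem F i P → x ∈ P) →
      ∀ z : W, z ∈ U O ↔ ∀ (i : M) (P : Y.Op), i ∈ I → PairMem F i P.1 → z ∈ U P)
    (map_empty : ∀ O : Y.Op, (∀ x : M, x ∉ O.1) → U O = ∅)
    (map_carrier : U ⟨Y.carrier, Y.carrier_mem⟩ = Set.univ) :
    ∃ h : W → Y', ∀ P : Y.Op, h ⁻¹' (χ.op P : Set Y') = U P := by
  let S : Setoid W := ⟨fun a b => ∀ P, a ∈ U P ↔ b ∈ U P, fun _ _ => Iff.rfl,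
    fun h P => (h P).symm, fun h h' P => (h P).trans (h' P)⟩
  let B : Y.Op → Set (Quotient S) := fun P =>
    {q | Quotient.lift (s := S) (fun w => w ∈ U P) (fun _ _ h => propext (h P)) q}
  let T : TopologicalSpace (Quotient S) := .generateFrom (Set.range B)
  have hB : ∀ P, IsOpen (B P) := fun P => .basic _ ⟨P, rfl⟩
  let ρ : Preinterpretation Y (Quotient S) :=
    { pt := fun x => Quotient.mk S (pt x)
      op := fun P => ⟨B P, hB P⟩
      t0 := by
        refine ⟨fun a b hab => ?_⟩
        induction a using Quotient.ind with | _ a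
        induction b using Quotient.ind with | _ b
        exact Quotient.sound fun P => hab.mem_open_iff (hB P)
      mem_iff := mem_iff
      -- Membership of a class in `B P` unfolds to membership of a representative in `U P`, so the
      -- hypotheses on `W` transfer directly.
      map_union := fun I F O hF hO => Quotient.ind fun w => map_union I F O hF hO w
      map_inter := fun I F O hF hI hO => Quotient.ind fun w => map_inter I F O hF hI hO w
      map_empty := fun O hO => by
        ext q
        induction q using Quotient.ind with | _ w
        change w ∈ U O ↔ False
        rw [map_empty O hO]
        rfl
      map_carrier := by
        ext q
        induction q using Quotient.ind with | _ w
        change w ∈ U _ ↔ True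
        rw [map_carrier]
        exact Iff.rfl
      isBasis := by
        have : ((fun V : TopologicalSpace.Opens (Quotient S) => (V : Set (Quotient S))) ''
            Set.range fun P => (⟨B P, hB P⟩ : TopologicalSpace.Opens (Quotient S))) =
            Set.range B := by
          rw [← Set.range_comp]
          rfl
        change TopologicalSpace.IsTopologicalBasis (_ '' _)
        rw [this]
        refine ⟨?_, ?_, rfl⟩
        -- The generating sets are closed under binary intersection because the open sets of `M`
        -- are, so they form a basis.
        · rintro _ ⟨P, rfl⟩ _ ⟨Q, rfl⟩ q hq
          obtain ⟨O, hO, hOPQ⟩ := Y.inter_mem P.1 Q.1 P.2 Q.2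
          have key : ∀ w : W, w ∈ U ⟨O, hO⟩ ↔ w ∈ U P ∧ w ∈ U Q :=
            mem_iff_of_inter hM map_inter ⟨O, hO⟩ P Q hOPQ
          have hBO : B ⟨O, hO⟩ = B P ∩ B Q :=
            Set.ext (Quotient.ind fun w => key w)
          exact ⟨_, ⟨⟨O, hO⟩, rfl⟩, hBO ▸ hq, hBO.subset⟩
        · refine Set.eq_univ_of_forall (Quotient.ind fun w => ?_)
          refine ⟨_, ⟨⟨Y.carrier, Y.carrier_mem⟩, rfl⟩, ?_⟩
          change w ∈ U _
          rw [map_carrier]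
          trivial }
  obtain ⟨h, -, hh⟩ := hχ (Quotient S) ρ
  refine ⟨fun w => h (Quotient.mk S w), fun P => ?_⟩
  ext w
  exact Set.ext_iff.1 (hh P) (Quotient.mk S w)

/-- A continuous function of `M` into an interpreted space has an interpretation that pulls back
open sets in the same way as the function does in `M`. -/
theorem exists_isMapInterpretation (hM : ModelsZFC M) {f : M}
    (hf : SpaceIn.ContinuousMap X Y f) {X' Y' : Type v} [TopologicalSpace X']
    [TopologicalSpace Y'] (π : Preinterpretation X X') {χ : Preinterpretation Y Y'}
    (hχ : IsInterpretation χ) :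
    ∃ f' : X' → Y', IsMapInterpretation π χ f f' ∧
      ∀ (O : X.Op) (P : Y.Op), IsPreimage f X.carrier P.1 O.1 →
        f' ⁻¹' (χ.op P : Set Y') = (π.op O : Set X') := by
  have hpre : ∀ P : Y.Op, ∃ O : X.Op, IsPreimage f X.carrier P.1 O.1 := fun P => by
    obtain ⟨O, hO, h⟩ := hf.2 P.1 P.2
    exact ⟨⟨O, hO⟩, h⟩
  -- `r P` is `f⁻¹P` computed in `M`.
  choose r hr using hpre
  have hr_eq : ∀ (O : X.Op) (P : Y.Op), IsPreimage f X.carrier P.1 O.1 → O = r P :=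
    fun O P h => Subtype.ext (h.unique hM (hr P))
  have hpull : ∀ {I F G : M}, IsFunction F I Y.opens →
      (∀ i O, PairMem G i O ↔ ∃ P, PairMem F i P ∧ IsPreimage f X.carrier P O) →
      ∀ (i : M) (O : X.Op), PairMem G i O.1 ↔ ∃ P : Y.Op, PairMem F i P.1 ∧ O = r P := by
    intro I F G hF hG i O
    rw [hG]
    constructor
    · rintro ⟨P, hP, hO⟩
      exact ⟨⟨P, (hF.mem_of_pairMem hM hP).2⟩, hP, hr_eq _ _ hO⟩
    · rintro ⟨P, hP, rfl⟩
      exact ⟨P.1, hP, hr P⟩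
  -- The summand `Y'` houses all points of `Y`; the summand `X'` is where the new map is read off.
  obtain ⟨h, hh⟩ := hχ.exists_map hM (W := Y' ⊕ X') (fun y => Sum.inl (χ.pt y))
    (fun P => {w | Sum.elim (fun y => y ∈ χ.op P) (fun x => x ∈ π.op (r P)) w})
    χ.mem_iff
    (by
      rintro I F O hF hO (z | z)
      · exact χ.map_union I F O hF hO z
      obtain ⟨G, hG, hGF⟩ := hf.exists_pullback_family hM hF
      have hpu := hpull hF hGF
      refine (π.map_union I G (r O) hG (fun x => ?_) z).trans ?_
      · simp only [hr O x, hGF, hO]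
        constructor
        · rintro ⟨hx, y, ⟨i, P, hi, hP, hyP⟩, hxy⟩
          obtain ⟨Q, -, hQ⟩ := hf.2 P (hF.mem_of_pairMem hM hP).2
          exact ⟨i, Q, hi, ⟨P, hP, hQ⟩, (hQ x).2 ⟨hx, y, hyP, hxy⟩⟩
        · rintro ⟨i, Q, hi, ⟨P, hP, hQ⟩, hxQ⟩
          obtain ⟨hx, y, hyP, hxy⟩ := (hQ x).1 hxQ
          exact ⟨hx, y, ⟨i, P, hi, hP, hyP⟩, hxy⟩
      · simp only [hpu]
        constructor
        · rintro ⟨i, _, hi, ⟨P, hP, rfl⟩, hz⟩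
          exact ⟨i, P, hi, hP, hz⟩
        · rintro ⟨i, P, hi, hP, hz⟩
          exact ⟨i, _, hi, ⟨P, hP, rfl⟩, hz⟩)
    (by
      rintro I F O hF hI hO (z | z)
      · exact χ.map_inter I F O hF hI hO z
      obtain ⟨G, hG, hGF⟩ := hf.exists_pullback_family hM hF
      have hpu := hpull hF hGF
      refine (π.map_inter I G (r O) hG hI (fun x => ?_) z).trans ?_
      · by_cases hx : x ∈ X.carrier
        · obtain ⟨y, hy, hxy⟩ := hf.1.exists_mem hM hx
          rw [(hr O).mem_iff_of_pairMem hM hf.1 hxy, hO]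
          simp only [hx, hy, true_and, hGF]
          constructor
          · rintro h i Q hi ⟨P, hP, hQ⟩
            exact (hQ.mem_iff_of_pairMem hM hf.1 hxy).2 (h i P hi hP)
          · intro h i P hi hP
            obtain ⟨Q, -, hQ⟩ := hf.2 P (hF.mem_of_pairMem hM hP).2
            exact (hQ.mem_iff_of_pairMem hM hf.1 hxy).1 (h i Q hi ⟨P, hP, hQ⟩)
        · simp only [hr O x, hx, false_and]
      · simp only [hpu]
        constructor
        · intro h i P hi hP
          exact h i _ hi ⟨P, hP, rfl⟩
        · rintro h i _ hi ⟨P, hP, rfl⟩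
          exact h i P hi hP)
    (by
      intro O hO
      have h1 := χ.map_empty O hO
      have h2 := π.map_empty (r O) fun x hx => by
        obtain ⟨-, y, hy, -⟩ := (hr O x).1 hx
        exact hO y hy
      ext (z | z)
      · simp [h1]
      · simp [h2])
    (by
      have h1 := χ.map_carrier
      have h2 : r ⟨Y.carrier, Y.carrier_mem⟩ = ⟨X.carrier, X.carrier_mem⟩ := by
        refine (hr_eq _ _ fun x => ?_).symm
        exact ⟨fun hx => ⟨hx, hf.1.exists_mem hM hx⟩, fun hx => hx.1⟩
      ext (z | z)
      · simp [h1]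
      · simp [h2, π.map_carrier])
  have hop : ∀ (x : X') (P : Y.Op), h (Sum.inr x) ∈ χ.op P ↔ x ∈ π.op (r P) :=
    fun x P => Set.ext_iff.1 (hh P) (Sum.inr x)
  refine ⟨fun x => h (Sum.inr x), ⟨?_, fun x y hxy => ?_⟩, fun O P hOP => ?_⟩
  · refine χ.isBasis.continuous_iff.2 ?_
    rintro _ ⟨_, ⟨P, rfl⟩, rfl⟩
    convert (π.op (r P)).2 using 1
    exact Set.ext fun x => hop x P
  -- Otherwise some `χ(P)` would separate `h (π x)` from `χ y`, while `x ∈ f⁻¹P` exactly when `y ∈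
  -- P`.
  · by_contra hne
    obtain ⟨P, hP⟩ := χ.exists_op_separating hne
    refine hP ?_
    rw [hop, ← π.mem_iff, ← χ.mem_iff]
    exact (hr P).mem_iff_of_pairMem hM hf.1 hxy
  · rw [hr_eq O P hOP]
    exact Set.ext fun x => hop x P

/-! ### Composites and inverses of interpreted maps -/

theorem IsMapInterpretation.comp (hM : ModelsZFC M) {Z : SpaceIn M} {X' Y' Z' : Type v}
    [TopologicalSpace X'] [TopologicalSpace Y'] [TopologicalSpace Z']
    {π : Preinterpretation X X'} {χ : Preinterpretation Y Y'} {ξ : Preinterpretation Z Z'}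
    {f g h : M} (hf : IsFunction f X.carrier Y.carrier) (hh : IsComp h g f)
    {f' : X' → Y'} {g' : Y' → Z'}
    (hf' : IsMapInterpretation π χ f f') (hg' : IsMapInterpretation χ ξ g g') :
    IsMapInterpretation π ξ h (g' ∘ f') := by
  refine ⟨hg'.1.comp hf'.1, fun x z hxz => ?_⟩
  obtain ⟨y, hxy, hyz⟩ := (pairMem_comp_iff hM hh).1 hxz
  have hy := (hf.mem_of_pairMem hM hxy).2
  rw [Function.comp_apply, hf'.2 x ⟨y, hy⟩ hxy, hg'.2 ⟨y, hy⟩ z hyz]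

/-- `g' ∘ f'` and the identity are continuous into a Hausdorff space and agree on the dense set
`π(X)`. -/
theorem IsMapInterpretation.leftInverse (hM : ModelsZFC M) (hX : X.RegularHausdorff)
    {X' Y' : Type v} [TopologicalSpace X'] [TopologicalSpace Y'] {π : Preinterpretation X X'}
    {χ : Preinterpretation Y Y'} {f g : M} (hf : IsFunction f X.carrier Y.carrier)
    (hfg : ∀ x y, PairMem f x y → PairMem g y x) {f' : X' → Y'} {g' : Y' → X'}
    (hf' : IsMapInterpretation π χ f f') (hg' : IsMapInterpretation χ π g g') :
    Function.LeftInverse g' f' := by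
  have := π.t2Space hM hX
  refine congrFun (π.denseRange_pt.equalizer (hg'.1.comp hf'.1)
    continuous_id (funext fun x => ?_))
  obtain ⟨y, hy, hxy⟩ := hf.exists_mem hM x.2
  simp only [Function.comp_apply]
  rw [hf'.2 x ⟨y, hy⟩ hxy, hg'.2 ⟨y, hy⟩ x (hfg _ _ hxy)]

end Preinterpretation

end Interp

theorem mainTheorem2 {M : Type u} [Membership M M] (hM : ModelsZFC M) :
    -- existence, uniqueness, and preimages of open sets
    (∀ (X Y : SpaceIn M), X.RegularHausdorff → Y.RegularHausdorff →
      ∀ f : M, SpaceIn.ContinuousMap X Y f →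
      ∀ (X' Y' : Type v) [TopologicalSpace X'] [TopologicalSpace Y']
        (π : Preinterpretation X X') (χ : Preinterpretation Y Y'),
      IsInterpretation π → IsInterpretation χ →
        (∃! f' : X' → Y', IsMapInterpretation π χ f f') ∧
        ∀ f' : X' → Y', IsMapInterpretation π χ f f' →
          ∀ (O : X.Op) (P : Y.Op), IsPreimage f X.carrier P.1 O.1 →
            f' ⁻¹' (χ.op P : Set Y') = (π.op O : Set X')) ∧
    -- interpretation commutes with composition
    (∀ (X Y Z : SpaceIn M), X.RegularHausdorff → Y.RegularHausdorff → Z.RegularHausdorff →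
      ∀ f g h : M, SpaceIn.ContinuousMap X Y f → SpaceIn.ContinuousMap Y Z g → IsComp h g f →
      ∀ (X' Y' Z' : Type v) [TopologicalSpace X'] [TopologicalSpace Y'] [TopologicalSpace Z']
        (π : Preinterpretation X X') (χ : Preinterpretation Y Y') (ξ : Preinterpretation Z Z'),
      IsInterpretation π → IsInterpretation χ → IsInterpretation ξ →
      ∀ (f' : X' → Y') (g' : Y' → Z'),
        IsMapInterpretation π χ f f' → IsMapInterpretation χ ξ g g' →
        ∀ h' : X' → Z', IsMapInterpretation π ξ h h' ↔ h' = g' ∘ f') ∧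
    -- the interpretation of a homeomorphism is a homeomorphism
    (∀ (X Y : SpaceIn M), X.RegularHausdorff → Y.RegularHausdorff →
      ∀ f : M, SpaceIn.Homeomorphism X Y f →
      ∀ (X' Y' : Type v) [TopologicalSpace X'] [TopologicalSpace Y']
        (π : Preinterpretation X X') (χ : Preinterpretation Y Y'),
      IsInterpretation π → IsInterpretation χ →
        ∀ f' : X' → Y', IsMapInterpretation π χ f f' → IsHomeomorph f') := by
  refine ⟨fun X Y _ hY f hf X' Y' _ _ π χ _ hχ => ?_,
    fun X Y Z _ _ hZ f g h hf hg hh X' Y' Z' _ _ _ π χ ξ _ _ _ f' g' hf' hg' h' => ?_,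
    fun X Y hX hY f hf X' Y' _ _ π χ hπ _ f' hf' => ?_⟩
  · obtain ⟨f₀, hf₀, hop⟩ := exists_isMapInterpretation hM hf π hχ
    have huniq : ∀ f', IsMapInterpretation π χ f f' → f' = f₀ := fun f' hf' =>
      hf'.unique hM hY (fun x hx => hf.1.exists_mem hM hx) hf₀
    refine ⟨⟨f₀, hf₀, huniq⟩, fun f' hf' => ?_⟩
    rw [huniq f' hf']
    exact hop
  · have hcomp := hf'.comp hM hf.1 hh hg'
    refine ⟨fun hh' => hh'.unique hM hZ (fun x hx => ?_) hcomp, fun hh' => hh' ▸ hcomp⟩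
    obtain ⟨y, hy, hxy⟩ := hf.1.exists_mem hM hx
    obtain ⟨z, hz, hyz⟩ := hg.1.exists_mem hM hy
    exact ⟨z, hz, (pairMem_comp_iff hM hh).2 ⟨y, hxy, hyz⟩⟩
  · obtain ⟨hf, g, hg, hfg⟩ := hf
    -- The inverse is the interpretation of `f⁻¹`, which exists by maximality of `π`.
    obtain ⟨g', hg', -⟩ := exists_isMapInterpretation hM hg χ hπ
    exact isHomeomorph_iff_exists_inverse.2 ⟨hf'.1, g',
      hf'.leftInverse hM hX hf.1 (fun x y => (hfg x y).1) hg',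
      hg'.leftInverse hM hY hg.1 (fun y x => (hfg x y).2) hf', hg'.1⟩
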